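/- **Theorem 2.** Let $k,l\ge 1$, $\sigma_a^2,\sigma_z^2>0$, and let $W\in\mathbb{R}^{k\times l}$ have no zero row (for instance, all $w_{i,j}\ne 0$). For $m\ge k$ let $n_m\ge 1$ be an integer, and let $\mathbf S=(S_1,\dots,S_k)$ be drawn uniformly from $[m]=\{1,\dots,m\}$ without replacement. Let $X=X(W,\mathbf S)\in\mathbb{R}^{m\times l}$ be the matrix whose row $S_j$ is row $j$ of $W$ for $j=1,\dots,k$ and whose other rows are zero, and let $\operatorname{supp}(X)$ be the set of indices of its nonzero rows. Let $Z\in\mathbb{R}^{n_m\times l}$ have i.i.d. $\mathcal N(0,\sigma_z^2)$ entries, independent of $\mathbf S$. Put $$c(W)=\min_{\emptyset\ne T\subseteq[k]}\ \frac{1}{2|T|}\log\det\Bigl(I+\frac{\sigma_a^2}{\sigma_z^2}W_T^{\top}W_T\Bigr),$$ where $W_T$ is the submatrix of the rows of $W$ indexed by $T$, and $\log$ is the natural logarithm. (a) *Gaussian measurements.* Let $A^{(m)}\in\mathbb{R}^{n_m\times m}$ have i.i.d. $\mathcal N(0,\sigma_a^2)$ entries, independent of $(\mathbf S,Z)$,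 and let $Y=A^{(m)}X+Z$. Let $d^{(m)}$, $m\ge k$, be any sequence of (measurable) support recovery maps, which assign to $Y$ and $A^{(m)}$ a subset of $[m]$, and let $P_m=\mathbb P\{d^{(m)}(A^{(m)},Y)\ne\operatorname{supp}(X)\}$, the probability being over $\mathbf S$, $A^{(m)}$ and $Z$. - If $\limsup_{m\to\infty}\frac{\log m}{n_m}>c(W)$, then $\limsup_{m\to\infty}P_m>0$, i.e. the error probability does not tend to $0$. - If $m_1<m_2<\cdots$ is any strictly increasing sequence with $\liminf_{j\to\infty}\frac{\log m_j}{n_{m_j}}>c(W)$, then $\liminf_{j\to\infty}P_{m_j}>0$. In particular, if $\liminf_{m\to\infty}\frac{\log m}{n_m}>c(W)$, then $\liminf_{m\to\infty}P_m>0$. (b) *Arbitrary measurements of bounded average power.* Let $A^{(m)}\in\mathbb{R}^{n_m\times m}$, $m\ge k$, be fixed matrices with $\frac{1}{n_m m}\|A^{(m)}\|_F^2\le\sigma_a^2$, and let $d^{(m)}:\mathbb{R}^{n_m\times l}\to 2^{[m]}$ be (measurable) support recovery maps. If $$\lim_{m\to\infty}\mathbb P\{d^{(m)}(A^{(m)}X+Z)\ne\operatorname{supp}(X)\}=0,$$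 the probability being over $\mathbf S$ and $Z$, then $$\limsup_{m\to\infty}\frac{\log m}{n_m}\le c(W).$$ -/

import Mathlib

open MeasureTheory ProbabilityTheory Filter Topology
open scoped NNReal Matrix

noncomputable section

namespace SupportRecovery

/-- Location vectors `(S₁, …, S_k) ∈ [m]^k` with distinct entries carry the discrete σ-algebra. -/
instance instMeasurableSpaceLocations (k m : ℕ) : MeasurableSpace (Fin k ↪ Fin m) := ⊤

/-- Matrices carry the product (Borel) σ-algebra of their entries. -/
instance instMeasurableSpaceMatrix (n q : ℕ) : MeasurableSpace (Matrix (Fin n) (Fin q) ℝ) :=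
  inferInstanceAs (MeasurableSpace (Fin n → Fin q → ℝ))

/-- The law of `(S₁, …, S_k)` drawn uniformly from `[m]` without replacement
(meaningful for `k ≤ m`). -/
def locationLaw (k m : ℕ) : Measure (Fin k ↪ Fin m) := uniformOn Set.univ

/-- The law of an `n × q` matrix with i.i.d. `N(0, v)` entries. -/
def gaussianMatrix (n q : ℕ) (v : ℝ≥0) : Measure (Matrix (Fin n) (Fin q) ℝ) :=
  Measure.pi fun _ : Fin n => Measure.pi fun _ : Fin q => gaussianReal 0 v

/-- The signal `X(W, S)`: row `S j` of `X` is row `j` of `W`, and the other rows are zero. -/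
def signal {k l m : ℕ} (W : Matrix (Fin k) (Fin l) ℝ) (S : Fin k ↪ Fin m) :
    Matrix (Fin m) (Fin l) ℝ :=
  fun s i => ∑ j : Fin k, if s = S j then W j i else 0

/-- The support of a matrix: the set of indices of its nonzero rows. -/
def supp {m l : ℕ} (X : Matrix (Fin m) (Fin l) ℝ) : Set (Fin m) :=
  {s | ∃ i, X s i ≠ 0}

/-- `c(W)`: the minimum, over the nonempty `T ⊆ [k]`, of
`(1 / (2|T|)) log det (I + (σ_a² / σ_z²) W_Tᵀ W_T)`, where `W_T` consists of the rows of `W`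
indexed by `T`; here `va = σ_a²` and `vz = σ_z²`. -/
def capacity {k l : ℕ} (va vz : ℝ≥0) (W : Matrix (Fin k) (Fin l) ℝ) : ℝ :=
  ⨅ T : {T : Finset (Fin k) // T.Nonempty},
    1 / (2 * (T.1.card : ℝ)) *
      Real.log (1 + ((va : ℝ) / (vz : ℝ)) •
        ((W.submatrix (fun i : T.1 => (i : Fin k)) id)ᵀ *
          W.submatrix (fun i : T.1 => (i : Fin k)) id)).det

/-- The average power `‖A‖_F² / (n m)` of an `n × m` matrix. -/
def avgPower {n m : ℕ} (A : Matrix (Fin n) (Fin m) ℝ) : ℝ :=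
  (∑ i, ∑ p, A i p ^ 2) / ((n : ℝ) * (m : ℝ))

/-- `P{d(A X + Z) ≠ supp X}` for a fixed measurement matrix `A`, over the randomness of the
independent `S` and `Z`. -/
def errorProbFixed {k l n m : ℕ} (vz : ℝ≥0) (W : Matrix (Fin k) (Fin l) ℝ)
    (A : Matrix (Fin n) (Fin m) ℝ) (d : Matrix (Fin n) (Fin l) ℝ → Set (Fin m)) : ℝ :=
  ((locationLaw k m).prod (gaussianMatrix n l vz)).real
    {ω | d (A * signal W ω.1 + ω.2) ≠ supp (signal W ω.1)}

/-- `P{d(A, A X + Z) ≠ supp X}` for a Gaussian measurement matrix `A`, over the randomness of the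
independent `S`, `A` and `Z`. The recovery map may use the realization of `A`. -/
def errorProbGaussian {k l n m : ℕ} (va vz : ℝ≥0) (W : Matrix (Fin k) (Fin l) ℝ)
    (d : Matrix (Fin n) (Fin m) ℝ → Matrix (Fin n) (Fin l) ℝ → Set (Fin m)) : ℝ :=
  ((locationLaw k m).prod ((gaussianMatrix n m va).prod (gaussianMatrix n l vz))).real
    {ω | d ω.2.1 (ω.2.1 * signal W ω.1 + ω.2.2) ≠ supp (signal W ω.1)}

/-- The rate `(log m) / n_m`, as an extended real (its upper limit may be `+∞`). -/
def rate (n : ℕ → ℕ) (m : ℕ) : EReal := ((Real.log (m : ℝ) / (n m : ℝ) : ℝ) : EReal)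

end SupportRecovery

end

/-!
A genie reveals the locations outside a set `T ⊆ [k]`. Compare the law of the observation given `S`
with a reference law that does not depend on the locations in `T`: their contribution is replaced by
its average, and the noise variance is raised accordingly. Under the reference law a recovery map
succeeds with probability at most `k! / (m - k + 1) ^ |T|`, so by the Gibbs variational inequality
`c P(E) ≤ KL(P ‖ Q) + e ^ c Q(E)` the success probability is at most about
`KL / (|T| log m)`. Multiplying `W` on the right by an orthogonal matrix leaves the problem
unchanged, so `W_Tᵀ W_T` may be assumed diagonal; the divergence averaged over `S` and over the
measurement matrix is then at most `(n / 2) (log det (1 + (va / vz) W_Tᵀ W_T) + o(1))`. Only the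
mean power of the measurement matrix enters this bound, so Gaussian and fixed matrices are two
instances of the same estimate for a random matrix of arbitrary law.
-/

namespace SupportRecovery

open InformationTheory Matrix
open scoped ENNReal

section ChangeOfMeasure

variable {Ω : Type*} [MeasurableSpace Ω] {P Q : Measure Ω}

lemma mul_le_klFun_add_exp (c : ℝ) {x : ℝ} (hx : 0 ≤ x) : c * x ≤ klFun x + Real.exp c := by
  rcases hx.eq_or_lt with rfl | hx
  · simpa [klFun_zero] using by positivity
  · have h : c - Real.log x + 1 ≤ Real.exp c / x := by
      simpa [Real.exp_sub, Real.exp_log hx] using Real.add_one_le_exp (c - Real.log x)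
    rw [le_div_iff₀ hx] at h
    rw [klFun_apply]
    linarith

lemma mul_measureReal_le_toReal_klDiv_add [IsFiniteMeasure P] [IsFiniteMeasure Q]
    (h : klDiv P Q ≠ ∞) (c : ℝ) (E : Set Ω) :
    c * P.real E ≤ (klDiv P Q).toReal + Real.exp c * Q.real E := by
  obtain ⟨hPQ, hint⟩ := klDiv_ne_top_iff.1 h
  have hkl := (integrable_klFun_rnDeriv_iff hPQ).2 hint
  have hnonneg : 0 ≤ fun x => klFun (P.rnDeriv Q x).toReal :=
    fun x => klFun_nonneg ENNReal.toReal_nonneg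
  calc c * P.real E = ∫ x in E, c * (P.rnDeriv Q x).toReal ∂Q := by
        rw [integral_const_mul, Measure.setIntegral_toReal_rnDeriv hPQ]
    _ ≤ ∫ x in E, (klFun (P.rnDeriv Q x).toReal + Real.exp c) ∂Q :=
        integral_mono (Measure.integrable_toReal_rnDeriv.integrableOn.const_mul c)
          (hkl.integrableOn.add (integrable_const _))
          fun x => mul_le_klFun_add_exp c ENNReal.toReal_nonneg
    _ = (∫ x in E, klFun (P.rnDeriv Q x).toReal ∂Q) + Real.exp c * Q.real E := by
        rw [integral_add hkl.integrableOn (integrable_const _)]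
        simp [mul_comm]
    _ ≤ (klDiv P Q).toReal + Real.exp c * Q.real E := by
        rw [toReal_klDiv_eq_integral_klFun hPQ]
        gcongr
        · exact ae_of_all _ hnonneg
        · exact Measure.restrict_le_self

end ChangeOfMeasure

section Tensorization

variable {ι : Type*} [Fintype ι] {X : ι → Type*} [∀ i, MeasurableSpace (X i)]
  {μ ν : ∀ i, Measure (X i)}

lemma lintegral_pi_prod_eq_prod_lintegral [∀ i, IsProbabilityMeasure (ν i)]
    {f : ∀ i, X i → ℝ≥0∞} (hf : ∀ i, Measurable (f i)) :
    ∫⁻ x, ∏ i, f i (x i) ∂Measure.pi ν = ∏ i, ∫⁻ x, f i x ∂ν i := by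
  refine (lintegral_prod_eq_prod_lintegral_of_indepFun Finset.univ _
    (iIndepFun_pi fun i => (hf i).aemeasurable)
    fun i => (hf i).comp (measurable_pi_apply i)).trans ?_
  exact Finset.prod_congr rfl fun i _ =>
    (measurePreserving_eval ν i).lintegral_comp (hf i)

lemma pi_withDensity [∀ i, IsProbabilityMeasure (ν i)] {f : ∀ i, X i → ℝ≥0∞}
    (hf : ∀ i, Measurable (f i)) [∀ i, SigmaFinite ((ν i).withDensity (f i))] :
    Measure.pi (fun i => (ν i).withDensity (f i)) =
      (Measure.pi ν).withDensity fun x => ∏ i, f i (x i) := by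
  refine Measure.pi_eq fun s hs => ?_
  have hind (x : ∀ i, X i) : (Set.univ.pi s).indicator (fun x => ∏ i, f i (x i)) x =
      ∏ i, (s i).indicator (f i) (x i) := by
    classical
    simp only [Set.indicator_apply, Finset.prod_ite_zero, Set.mem_univ_pi, Finset.mem_univ,
      true_imp_iff]
  rw [withDensity_apply _ (.univ_pi hs), ← lintegral_indicator (.univ_pi hs)]
  simp_rw [hind, lintegral_pi_prod_eq_prod_lintegral fun i => (hf i).indicator (hs i),
    lintegral_indicator (hs _), withDensity_apply _ (hs _)]

variable [∀ i, IsProbabilityMeasure (μ i)] [∀ i, IsProbabilityMeasure (ν i)]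

lemma pi_eq_withDensity_prod_rnDeriv (h : ∀ i, μ i ≪ ν i) :
    Measure.pi μ = (Measure.pi ν).withDensity fun x => ∏ i, (μ i).rnDeriv (ν i) (x i) := by
  rw [← pi_withDensity fun i => Measure.measurable_rnDeriv _ _]
  simp_rw [Measure.withDensity_rnDeriv_eq _ _ (h _)]

lemma pi_absolutelyContinuous (h : ∀ i, μ i ≪ ν i) : Measure.pi μ ≪ Measure.pi ν := by
  rw [pi_eq_withDensity_prod_rnDeriv h]
  exact withDensity_absolutelyContinuous _ _

lemma llr_pi (h : ∀ i, μ i ≪ ν i) :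
    llr (Measure.pi μ) (Measure.pi ν) =ᵐ[Measure.pi μ]
      fun x => ∑ i, llr (μ i) (ν i) (x i) := by
  have hmeas : Measurable fun x : ∀ i, X i => ∏ i, (μ i).rnDeriv (ν i) (x i) := by fun_prop
  have hprod : (Measure.pi μ).rnDeriv (Measure.pi ν) =ᵐ[Measure.pi μ]
      fun x => ∏ i, (μ i).rnDeriv (ν i) (x i) := by
    refine (pi_absolutelyContinuous h).ae_le ?_
    rw [pi_eq_withDensity_prod_rnDeriv h]
    exact Measure.rnDeriv_withDensity _ hmeas
  have hpos i : ∀ᵐ y ∂μ i, 0 < ((μ i).rnDeriv (ν i) y).toReal := by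
    filter_upwards [Measure.rnDeriv_pos (h i), (h i).ae_le (Measure.rnDeriv_lt_top (μ i) (ν i))]
      with y hpos htop using ENNReal.toReal_pos hpos.ne' htop.ne
  have hpos_pi : ∀ᵐ x ∂Measure.pi μ, ∀ i, 0 < ((μ i).rnDeriv (ν i) (x i)).toReal :=
    ae_all_iff.2 fun i => (Measure.quasiMeasurePreserving_eval μ i).ae (hpos i)
  filter_upwards [hprod, hpos_pi] with x hx hx0
  simp only [llr, hx, ENNReal.toReal_prod, Real.log_prod fun i _ => (hx0 i).ne']

lemma klDiv_pi_ne_top (h : ∀ i, klDiv (μ i) (ν i) ≠ ∞) :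
    klDiv (Measure.pi μ) (Measure.pi ν) ≠ ∞ := by
  have hac i := (klDiv_ne_top_iff.1 (h i)).1
  have hint i := (klDiv_ne_top_iff.1 (h i)).2
  exact klDiv_ne_top (pi_absolutelyContinuous hac) <| (integrable_congr (llr_pi hac)).2 <|
    integrable_finsetSum _ fun i _ => integrable_comp_eval (hint i)

lemma toReal_klDiv_pi (h : ∀ i, klDiv (μ i) (ν i) ≠ ∞) :
    (klDiv (Measure.pi μ) (Measure.pi ν)).toReal = ∑ i, (klDiv (μ i) (ν i)).toReal := by
  have hac i := (klDiv_ne_top_iff.1 (h i)).1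
  have hint i := (klDiv_ne_top_iff.1 (h i)).2
  rw [toReal_klDiv_of_measure_eq (pi_absolutelyContinuous hac) (by simp),
    integral_congr_ae (llr_pi hac),
    integral_finsetSum _ fun i _ => integrable_comp_eval (hint i)]
  refine Finset.sum_congr rfl fun i _ => ?_
  rw [toReal_klDiv_of_measure_eq (hac i) (by simp)]
  exact integral_comp_eval (hint i).aestronglyMeasurable

end Tensorization

section GaussianDivergence

lemma log_gaussianPDFReal (a : ℝ) {v : ℝ≥0} (hv : v ≠ 0) (x : ℝ) :
    Real.log (gaussianPDFReal a v x) =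
      -(Real.log (2 * Real.pi) + Real.log v) / 2 - (x - a) ^ 2 / (2 * v) := by
  have hv' : (0 : ℝ) < v := by positivity
  rw [gaussianPDFReal, Real.log_mul (by positivity) (Real.exp_ne_zero _), Real.log_exp,
    Real.log_inv, Real.log_sqrt (by positivity), Real.log_mul (by positivity) hv'.ne']
  ring

variable (a b : ℝ) {v w : ℝ≥0}

lemma gaussianReal_absolutelyContinuous_gaussianReal (hv : v ≠ 0) (hw : w ≠ 0) :
    gaussianReal a v ≪ gaussianReal b w :=
  (gaussianReal_absolutelyContinuous a hv).trans (gaussianReal_absolutelyContinuous' b hw)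

lemma llr_gaussianReal (hv : v ≠ 0) (hw : w ≠ 0) :
    llr (gaussianReal a v) (gaussianReal b w) =ᵐ[gaussianReal a v] fun x =>
      Real.log (w / v) / 2 + (x - b) ^ 2 / (2 * w) - (x - a) ^ 2 / (2 * v) := by
  have hvol := gaussianReal_absolutelyContinuous a hv
  have hwol := gaussianReal_absolutelyContinuous b hw
  filter_upwards [(gaussianReal_absolutelyContinuous_gaussianReal a b hv hw).ae_le
    (Measure.rnDeriv_eq_div hvol hwol), hvol.ae_le (rnDeriv_gaussianReal a v),
    hvol.ae_le (rnDeriv_gaussianReal b w)] with x hx ha hb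
  rw [llr, hx, ha, hb, ENNReal.toReal_div, toReal_gaussianPDF, toReal_gaussianPDF,
    Real.log_div (gaussianPDFReal_pos a v x hv).ne' (gaussianPDFReal_pos b w x hw).ne',
    log_gaussianPDFReal a hv, log_gaussianPDFReal b hw,
    Real.log_div (NNReal.coe_ne_zero.2 hw) (NNReal.coe_ne_zero.2 hv)]
  ring

lemma integrable_sq_sub_gaussianReal : Integrable (fun x => (x - b) ^ 2) (gaussianReal a v) :=
  ((memLp_id_gaussianReal 2).sub (memLp_const b)).integrable_sq

lemma integral_sq_sub_gaussianReal :
    ∫ x, (x - b) ^ 2 ∂gaussianReal a v = v + (a - b) ^ 2 := by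
  have hmean : ∫ x, x - b ∂gaussianReal a v = a - b := by
    have hid : Integrable (fun x => x) (gaussianReal a v) :=
      (memLp_id_gaussianReal 1).integrable le_rfl
    rw [integral_sub hid (integrable_const b)]
    simp only [integral_id_gaussianReal, integral_const, probReal_univ, smul_eq_mul, one_mul]
  have hvar : Var[fun x => x - b; gaussianReal a v] = v :=
    (variance_sub_const (by fun_prop) b).trans variance_fun_id_gaussianReal
  have hmem : MemLp (fun x => x - b) 2 (gaussianReal a v) :=
    (memLp_id_gaussianReal 2).sub (memLp_const b)
  rw [variance_eq_sub hmem, hmean] at hvar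
  exact eq_add_of_sub_eq hvar

lemma klDiv_gaussianReal_ne_top (hv : v ≠ 0) (hw : w ≠ 0) :
    klDiv (gaussianReal a v) (gaussianReal b w) ≠ ∞ := by
  refine klDiv_ne_top (gaussianReal_absolutelyContinuous_gaussianReal a b hv hw) ?_
  rw [integrable_congr (llr_gaussianReal a b hv hw)]
  exact ((integrable_const _).add ((integrable_sq_sub_gaussianReal a b).div_const _)).sub
    ((integrable_sq_sub_gaussianReal a a).div_const _)

lemma toReal_klDiv_gaussianReal (hv : v ≠ 0) (hw : w ≠ 0) :
    (klDiv (gaussianReal a v) (gaussianReal b w)).toReal =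
      (Real.log (w / v) + v / w - 1 + (a - b) ^ 2 / w) / 2 := by
  have hla := (integrable_sq_sub_gaussianReal (v := v) a a).div_const (2 * v)
  have hlb := (integrable_sq_sub_gaussianReal (v := v) a b).div_const (2 * w)
  have hconst := integrable_const (μ := gaussianReal a v) (Real.log (w / v) / 2)
  rw [toReal_klDiv_of_measure_eq (gaussianReal_absolutelyContinuous_gaussianReal a b hv hw)
    (by simp), integral_congr_ae (llr_gaussianReal a b hv hw),
    integral_sub (hconst.fun_add hlb) hla, integral_add hconst hlb]
  have hv' : (v : ℝ) ≠ 0 := NNReal.coe_ne_zero.2 hv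
  have hw' : (w : ℝ) ≠ 0 := NNReal.coe_ne_zero.2 hw
  simp only [integral_div, integral_sq_sub_gaussianReal, integral_const, probReal_univ,
    smul_eq_mul, one_mul, sub_self]
  field_simp
  ring

end GaussianDivergence

section GaussianVector

variable {ι : Type*} [Fintype ι]

/-- The law of a vector with independent Gaussian entries, with means `a` and variances `v`. -/
noncomputable def gaussianVector (a : ι → ℝ) (v : ι → ℝ≥0) : Measure (ι → ℝ) :=
  Measure.pi fun r => gaussianReal (a r) (v r)

instance (a : ι → ℝ) (v : ι → ℝ≥0) : IsProbabilityMeasure (gaussianVector a v) :=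
  inferInstanceAs (IsProbabilityMeasure (Measure.pi _))

lemma map_const_add_gaussianVector (a : ι → ℝ) (v : ι → ℝ≥0) :
    (gaussianVector 0 v).map (a + ·) = gaussianVector a v := by
  have hentry r : (gaussianReal 0 (v r)).map (a r + ·) = gaussianReal (a r) (v r) := by
    rw [gaussianReal_map_const_add, zero_add]
  have : ∀ r, IsProbabilityMeasure ((gaussianReal 0 (v r)).map (a r + ·)) := fun r => by
    rw [hentry]; infer_instance
  exact (Measure.pi_map_pi (f := fun r x => a r + x) fun _ => by fun_prop).trans
    (congrArg Measure.pi (funext hentry))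

lemma klDiv_gaussianVector_ne_top (a a' : ι → ℝ) {v v' : ι → ℝ≥0} (hv : ∀ r, v r ≠ 0)
    (hv' : ∀ r, v' r ≠ 0) : klDiv (gaussianVector a v) (gaussianVector a' v') ≠ ∞ :=
  klDiv_pi_ne_top fun r => klDiv_gaussianReal_ne_top (a r) (a' r) (hv r) (hv' r)

lemma toReal_klDiv_gaussianVector (a a' : ι → ℝ) {v v' : ι → ℝ≥0} (hv : ∀ r, v r ≠ 0)
    (hv' : ∀ r, v' r ≠ 0) :
    (klDiv (gaussianVector a v) (gaussianVector a' v')).toReal =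
      ∑ r, (Real.log (v' r / v r) + v r / v' r - 1 + (a r - a' r) ^ 2 / v' r) / 2 := by
  refine (toReal_klDiv_pi fun r =>
    klDiv_gaussianReal_ne_top (a r) (a' r) (hv r) (hv' r)).trans ?_
  simp_rw [toReal_klDiv_gaussianReal _ _ (hv _) (hv' _)]

lemma map_smul_pi_gaussianReal (v : ℝ≥0) :
    (Measure.pi fun _ : ι => gaussianReal 0 1).map (fun z => √(v : ℝ) • z) =
      Measure.pi fun _ : ι => gaussianReal 0 v := by
  have hscale : (gaussianReal 0 1).map (√(v : ℝ) * ·) = gaussianReal 0 v := by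
    rw [gaussianReal_map_const_mul]
    congr 1
    · simp
    · ext; simp
  have : IsProbabilityMeasure ((gaussianReal 0 1).map (√(v : ℝ) * ·)) := by
    rw [hscale]; infer_instance
  refine (Measure.pi_map_pi (f := fun (_ : ι) x => √(v : ℝ) * x) fun _ => by fun_prop).trans ?_
  simp_rw [hscale]

variable [DecidableEq ι]

lemma map_mulVec_pi_gaussianReal_one {U : Matrix ι ι ℝ} (hU : U ∈ orthogonalGroup ι ℝ) :
    (Measure.pi fun _ : ι => gaussianReal 0 1).map (U *ᵥ ·) =
      Measure.pi fun _ : ι => gaussianReal 0 1 := by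
  let f := Unitary.linearIsometryEquiv
    ⟨toEuclideanCLM (𝕜 := ℝ) U, Unitary.map_mem (toEuclideanCLM (n := ι) (𝕜 := ℝ)) hU⟩
  have hf : (WithLp.toLp 2 ∘ (U *ᵥ ·) : (ι → ℝ) → EuclideanSpace ℝ ι) = f ∘ WithLp.toLp 2 := rfl
  have hofLp (μ : Measure (ι → ℝ)) :
      (μ.map (WithLp.toLp 2 : _ → EuclideanSpace ℝ ι)).map WithLp.ofLp = μ := by
    rw [Measure.map_map (by fun_prop) (by fun_prop)]
    exact Measure.map_id
  rw [← hofLp (Measure.map _ _), Measure.map_map (g := WithLp.toLp 2) (by fun_prop) (by fun_prop),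
    hf, ← Measure.map_map (by fun_prop) (by fun_prop), map_pi_eq_stdGaussian, stdGaussian_map,
    ← map_pi_eq_stdGaussian, hofLp]

lemma map_mulVec_pi_gaussianReal {U : Matrix ι ι ℝ} (hU : U ∈ orthogonalGroup ι ℝ) (v : ℝ≥0) :
    (Measure.pi fun _ : ι => gaussianReal 0 v).map (U *ᵥ ·) =
      Measure.pi fun _ : ι => gaussianReal 0 v := by
  have hcomm : (U *ᵥ ·) ∘ (fun z : ι → ℝ => √(v : ℝ) • z) =
      (fun z => √(v : ℝ) • z) ∘ (U *ᵥ ·) := by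
    ext1 z
    exact mulVec_smul U _ z
  rw [← map_smul_pi_gaussianReal, Measure.map_map (by fun_prop) (by fun_prop), hcomm,
    ← Measure.map_map (by fun_prop) (by fun_prop), map_mulVec_pi_gaussianReal_one hU]

end GaussianVector

section GaussianMatrix

instance (n q : ℕ) (v : ℝ≥0) : IsProbabilityMeasure (gaussianMatrix n q v) :=
  inferInstanceAs (IsProbabilityMeasure (Measure.pi _))

/-- The law of an `n × l` matrix with independent Gaussian entries, with mean matrix `M` and with
variance `v r` throughout column `r`. -/
noncomputable def gaussianEntries {n l : ℕ} (M : Matrix (Fin n) (Fin l) ℝ)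
    (v : Fin l → ℝ≥0) : Measure (Matrix (Fin n) (Fin l) ℝ) :=
  Measure.pi fun i => gaussianVector (M.row i) v

variable {n l : ℕ}

instance (M : Matrix (Fin n) (Fin l) ℝ) (v : Fin l → ℝ≥0) :
    IsProbabilityMeasure (gaussianEntries M v) :=
  inferInstanceAs (IsProbabilityMeasure (Measure.pi _))

lemma map_const_add_gaussianMatrix (M : Matrix (Fin n) (Fin l) ℝ) (v : ℝ≥0) :
    (gaussianMatrix n l v).map (M + ·) = gaussianEntries M fun _ => v := by
  have hrow i : (gaussianVector 0 fun _ => v).map (M i + ·) = gaussianVector (M i) fun _ => v :=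
    map_const_add_gaussianVector _ _
  have : ∀ i, IsProbabilityMeasure ((gaussianVector 0 fun _ => v).map (M i + ·)) := fun i => by
    rw [hrow]; infer_instance
  exact (Measure.pi_map_pi (f := fun i x => M i + x) fun _ => by fun_prop).trans
    (congrArg Measure.pi (funext hrow))

lemma map_mul_gaussianMatrix {U : Matrix (Fin l) (Fin l) ℝ} (hU : U ∈ orthogonalGroup (Fin l) ℝ)
    (v : ℝ≥0) : (gaussianMatrix n l v).map (· * U) = gaussianMatrix n l v := by
  have hrow : (Measure.pi fun _ => gaussianReal 0 v).map (Uᵀ *ᵥ ·) =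
      Measure.pi fun _ => gaussianReal 0 v :=
    map_mulVec_pi_gaussianReal (Unitary.star_mem hU) v
  have : IsProbabilityMeasure ((Measure.pi fun _ => gaussianReal 0 v).map (Uᵀ *ᵥ ·)) := by
    rw [hrow]; infer_instance
  have hmul : (· * U : Matrix (Fin n) (Fin l) ℝ → _) = fun Z i => Uᵀ *ᵥ Z i := by
    ext1 Z
    ext i r
    simp [mul_apply, mulVec, dotProduct, mul_comm]
  rw [hmul]
  exact (Measure.pi_map_pi (f := fun _ z => Uᵀ *ᵥ z) fun _ => by fun_prop).trans
    (congrArg Measure.pi (funext fun _ => hrow))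

variable (M M' : Matrix (Fin n) (Fin l) ℝ) {v v' : Fin l → ℝ≥0}

lemma klDiv_gaussianEntries_ne_top (hv : ∀ r, v r ≠ 0) (hv' : ∀ r, v' r ≠ 0) :
    klDiv (gaussianEntries M v) (gaussianEntries M' v') ≠ ∞ :=
  klDiv_pi_ne_top fun i => klDiv_gaussianVector_ne_top (M.row i) (M'.row i) hv hv'

lemma toReal_klDiv_gaussianEntries (hv : ∀ r, v r ≠ 0) (hv' : ∀ r, v' r ≠ 0) :
    (klDiv (gaussianEntries M v) (gaussianEntries M' v')).toReal =
      ∑ i, ∑ r, (Real.log (v' r / v r) + v r / v' r - 1 + (M i r - M' i r) ^ 2 / v' r) / 2 := by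
  refine (toReal_klDiv_pi fun i => klDiv_gaussianVector_ne_top (M.row i) (M'.row i) hv hv').trans ?_
  simp_rw [toReal_klDiv_gaussianVector _ _ hv hv', row_apply]

end GaussianMatrix

section Counting

open scoped Nat Finset

variable {α β : Type*} [Fintype α] [Fintype β]

open Classical in
lemma card_filter_range_eq_le (B : Set α) :
    #{S : β ↪ α | Set.range S = B} ≤ (Fintype.card β)! := by
  let toEquiv (S : {S : β ↪ α // Set.range S = B}) : β ≃ B :=
    (Equiv.ofInjective S.1 S.1.injective).trans (Equiv.setCongr S.2)
  have hinj : Function.Injective toEquiv := fun S S' h =>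
    Subtype.ext <| DFunLike.ext _ _ fun j => congrArg Subtype.val (DFunLike.congr_fun h j)
  rw [← Fintype.card_subtype]
  refine (Fintype.card_le_of_injective toEquiv hinj).trans ?_
  rcases isEmpty_or_nonempty (β ≃ B) with h | ⟨⟨e⟩⟩
  · simp
  · exact (Fintype.card_equiv e).le

lemma sum_measureReal_eq_range_le {Ω : Type*} [MeasurableSpace Ω] (μ : Measure Ω)
    [IsProbabilityMeasure μ] {d : Ω → Set α} (hd : Measurable d) :
    ∑ S : β ↪ α, μ.real {ω | d ω = Set.range S} ≤ (Fintype.card β)! := by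
  classical
  calc ∑ S : β ↪ α, μ.real {ω | d ω = Set.range S}
    _ = ∑ B : Set α, #{S : β ↪ α | Set.range S = B} • μ.real (d ⁻¹' {B}) := by
      rw [← Finset.sum_fiberwise Finset.univ fun S : β ↪ α => Set.range S]
      refine Finset.sum_congr rfl fun B _ => Finset.sum_eq_card_nsmul fun S hS => ?_
      rw [(Finset.mem_filter.1 hS).2]
      rfl
    _ ≤ ∑ B : Set α, (Fintype.card β)! • μ.real (d ⁻¹' {B}) := by
      gcongr
      exact card_filter_range_eq_le _
    _ = (Fintype.card β)! := by
      rw [← Finset.smul_sum, sum_measureReal_preimage_singleton _ fun B _ =>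
        hd (measurableSet_singleton B)]
      simp

/-- Overwriting the locations indexed by `T` with fresh ones. -/
def overwrite [DecidableEq β] (T : Finset β) (S : β ↪ α)
    (e : T ↪ {p // p ∉ Tᶜ.map S}) : β ↪ α where
  toFun j := if h : j ∈ T then e ⟨j, h⟩ else S j
  inj' := Function.Injective.dite (· ∈ T) (f := fun j => (e j : α)) (f' := fun j => S j)
    (Subtype.val_injective.comp e.injective) (S.injective.comp Subtype.val_injective)
    fun {_ _ _ hj'} h => (e _).2 <| h ▸ Finset.mem_map_of_mem S (Finset.mem_compl.2 hj')

open Classical in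
lemma pow_le_card_filter_agree (T : Finset β) (S : β ↪ α) :
    (Fintype.card α - Fintype.card β + 1) ^ #T ≤ #{S' : β ↪ α | ∀ j ∉ T, S' j = S j} := by
  have hβα := Fintype.card_le_of_embedding S
  have hT : #T ≤ Fintype.card β := T.card_le_univ
  have hfresh : Fintype.card {p // p ∉ Tᶜ.map S} = Fintype.card α - (Fintype.card β - #T) := by
    rw [Fintype.card_subtype_compl (· ∈ Tᶜ.map S), Fintype.card_coe, Finset.card_map,
      Finset.card_compl]
  have hinj : Function.Injective (overwrite T S) := fun e e' h => by
    ext ⟨j, hj⟩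
    simpa [overwrite, hj] using DFunLike.congr_fun h j
  calc (Fintype.card α - Fintype.card β + 1) ^ #T
    _ ≤ (Fintype.card α - (Fintype.card β - #T)).descFactorial #T := by
      refine le_trans (Nat.pow_le_pow_left ?_ _) (Nat.pow_sub_le_descFactorial _ _)
      lia
    _ = #(Finset.univ.map ⟨overwrite T S, hinj⟩) := by
      rw [Finset.card_map, Finset.card_univ, Fintype.card_embedding_eq, hfresh, Fintype.card_coe]
    _ ≤ #{S' : β ↪ α | ∀ j ∉ T, S' j = S j} := by
      refine Finset.card_le_card fun S' hS' => ?_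
      obtain ⟨e, -, rfl⟩ := Finset.mem_map.1 hS'
      exact Finset.mem_filter.2 ⟨Finset.mem_univ _, fun j hj => dif_neg hj⟩

/-- Even a genie revealing the locations off `T` leaves `(|α| - |β| + 1) ^ |T|` candidates, of which
a recovery map can serve only `|β|!` at a time. -/
lemma pow_mul_sum_measureReal_eq_range_le {Ω : Type*} [MeasurableSpace Ω] (T : Finset β)
    (Q : (β ↪ α) → Measure Ω) [∀ S, IsProbabilityMeasure (Q S)]
    (hQ : ∀ S S', (∀ j ∉ T, S' j = S j) → Q S' = Q S) {d : Ω → Set α} (hd : Measurable d) :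
    ((Fintype.card α - Fintype.card β + 1 : ℕ) : ℝ) ^ #T *
        ∑ S, (Q S).real {ω | d ω = Set.range S} ≤
      (Fintype.card β)! * Fintype.card (β ↪ α) := by
  classical
  calc ((Fintype.card α - Fintype.card β + 1 : ℕ) : ℝ) ^ #T *
        ∑ S, (Q S).real {ω | d ω = Set.range S}
    _ ≤ ∑ S : β ↪ α, ∑ S' with ∀ j ∉ T, S' j = S j, (Q S').real {ω | d ω = Set.range S} := by
      rw [Finset.mul_sum]
      refine Finset.sum_le_sum fun S _ => ?_
      rw [Finset.sum_congr rfl fun S' hS' => by rw [hQ S S' (Finset.mem_filter.1 hS').2],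
        Finset.sum_const, nsmul_eq_mul]
      gcongr
      exact_mod_cast pow_le_card_filter_agree T S
    _ ≤ ∑ S : β ↪ α, ∑ S', (Q S').real {ω | d ω = Set.range S} := by
      gcongr
      exact Finset.filter_subset _ _
    _ = ∑ S', ∑ S : β ↪ α, (Q S').real {ω | d ω = Set.range S} := Finset.sum_comm
    _ ≤ ∑ _S' : β ↪ α, ((Fintype.card β)! : ℝ) :=
      Finset.sum_le_sum fun S' _ => sum_measureReal_eq_range_le (Q S') hd
    _ = (Fintype.card β)! * Fintype.card (β ↪ α) := by
      rw [Finset.sum_const, Finset.card_univ, nsmul_eq_mul, mul_comm]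

lemma log_mul_sum_measureReal_eq_range_le {Ω : Type*} [MeasurableSpace Ω] (T : Finset β)
    (P Q : (β ↪ α) → Measure Ω) [∀ S, IsProbabilityMeasure (P S)]
    [∀ S, IsProbabilityMeasure (Q S)] (hPQ : ∀ S, klDiv (P S) (Q S) ≠ ∞)
    (hQ : ∀ S S', (∀ j ∉ T, S' j = S j) → Q S' = Q S) {d : Ω → Set α} (hd : Measurable d) :
    Real.log (((Fintype.card α - Fintype.card β + 1 : ℕ) : ℝ) ^ #T / (Fintype.card β)!) *
        ∑ S, (P S).real {ω | d ω = Set.range S} ≤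
      ∑ S, (klDiv (P S) (Q S)).toReal + Fintype.card (β ↪ α) := by
  set M : ℝ := ((Fintype.card α - Fintype.card β + 1 : ℕ) : ℝ) ^ #T / (Fintype.card β)! with hM
  have hM0 : 0 < M := by positivity
  have hguess : M * ∑ S, (Q S).real {ω | d ω = Set.range S} ≤ Fintype.card (β ↪ α) := by
    rw [hM, div_mul_eq_mul_div, div_le_iff₀' (by positivity)]
    exact pow_mul_sum_measureReal_eq_range_le T Q hQ hd
  calc Real.log M * ∑ S, (P S).real {ω | d ω = Set.range S}
    _ = ∑ S, Real.log M * (P S).real {ω | d ω = Set.range S} := Finset.mul_sum ..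
    _ ≤ ∑ S, ((klDiv (P S) (Q S)).toReal + M * (Q S).real {ω | d ω = Set.range S}) := by
      refine Finset.sum_le_sum fun S _ => ?_
      simpa only [Real.exp_log hM0] using
        mul_measureReal_le_toReal_klDiv_add (hPQ S) (Real.log M) {ω | d ω = Set.range S}
    _ ≤ ∑ S, (klDiv (P S) (Q S)).toReal + Fintype.card (β ↪ α) := by
      rw [Finset.sum_add_distrib, ← Finset.mul_sum]
      gcongr

end Counting

section SamplingWithoutReplacement

open scoped Nat

variable {α β : Type*} [Fintype α]

section Permutations

variable [DecidableEq α]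

lemma sum_perm_mul_apply (g : α → ℝ) (σ : Equiv.Perm α) (a b : α) :
    ∑ π : Equiv.Perm α, g (π (σ a)) * g (π (σ b)) = ∑ π : Equiv.Perm α, g (π a) * g (π b) :=
  Fintype.sum_equiv (Equiv.mulRight σ) _ _ fun _ => rfl

lemma sum_perm_apply_mul_self (g : α → ℝ) (a : α) :
    ∑ π : Equiv.Perm α, g (π a) * g (π a) =
      (Fintype.card α)! * (∑ p, g p ^ 2) / Fintype.card α := by
  have hcard : (Fintype.card α : ℝ) ≠ 0 := by
    exact_mod_cast (Fintype.card_pos_iff.2 ⟨a⟩).ne'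
  rw [eq_div_iff hcard]
  calc (∑ π : Equiv.Perm α, g (π a) * g (π a)) * Fintype.card α
    _ = ∑ _b : α, ∑ π : Equiv.Perm α, g (π a) * g (π a) := by
      rw [Finset.sum_const, Finset.card_univ, nsmul_eq_mul, mul_comm]
    _ = ∑ b, ∑ π : Equiv.Perm α, g (π b) * g (π b) := by
      refine Finset.sum_congr rfl fun b _ => ?_
      simpa only [Equiv.swap_apply_left] using (sum_perm_mul_apply g (Equiv.swap a b) a a).symm
    _ = ∑ π : Equiv.Perm α, ∑ b, g (π b) ^ 2 := by
      rw [Finset.sum_comm]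
      simp_rw [sq]
    _ = (Fintype.card α)! * ∑ p, g p ^ 2 := by
      simp_rw [Equiv.sum_comp _ fun p => g p ^ 2]
      rw [Finset.sum_const, Finset.card_univ, Fintype.card_perm, nsmul_eq_mul]

lemma sum_perm_apply_mul_apply {g : α → ℝ} (hg : ∑ p, g p = 0) {a b : α} (hab : a ≠ b) :
    ∑ π : Equiv.Perm α, g (π a) * g (π b) =
      -(∑ π : Equiv.Perm α, g (π a) * g (π a)) / (Fintype.card α - 1) := by
  have hcard : (1 : ℝ) < Fintype.card α := by
    exact_mod_cast Fintype.one_lt_card_iff.2 ⟨a, b, hab⟩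
  have hsymm c (hc : c ∈ Finset.univ.erase a) :
      ∑ π : Equiv.Perm α, g (π a) * g (π c) = ∑ π : Equiv.Perm α, g (π a) * g (π b) := by
    have h := sum_perm_mul_apply g (Equiv.swap b c) a b
    rwa [Equiv.swap_apply_of_ne_of_ne hab (Finset.ne_of_mem_erase hc).symm,
      Equiv.swap_apply_left] at h
  have hzero : ∑ c, ∑ π : Equiv.Perm α, g (π a) * g (π c) = 0 := by
    rw [Finset.sum_comm]
    refine Finset.sum_eq_zero fun π _ => ?_
    rw [← Finset.mul_sum, Equiv.sum_comp π g, hg, mul_zero]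
  rw [← Finset.add_sum_erase _ _ (Finset.mem_univ a), Finset.sum_congr rfl hsymm,
    Finset.sum_const, Finset.card_erase_of_mem (Finset.mem_univ a), Finset.card_univ,
    nsmul_eq_mul, Nat.cast_pred (Fintype.card_pos_iff.2 ⟨a⟩)] at hzero
  rw [eq_div_iff (sub_pos.2 hcard).ne']
  linarith

lemma sum_perm_sq_le {g : α → ℝ} (hg : ∑ p, g p = 0) (hα : 1 < Fintype.card α) (T : Finset β)
    (u : β → ℝ) (S : β ↪ α) :
    ∑ π : Equiv.Perm α, (∑ j ∈ T, u j * g (π (S j))) ^ 2 ≤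
      (Fintype.card α)! * ((∑ j ∈ T, u j ^ 2) * (∑ p, g p ^ 2) / (Fintype.card α - 1)) := by
  classical
  set N : ℝ := ↑(Fintype.card α) with hN
  have hN1 : 0 < N - 1 := sub_pos.2 (by rw [hN]; exact_mod_cast hα)
  have : 0 < N := by linarith
  set G : ℝ := (Fintype.card α)! * ∑ p, g p ^ 2 with hG
  have hmoment i j : ∑ π : Equiv.Perm α, g (π (S i)) * g (π (S j)) =
      (if i = j then G / (N - 1) else 0) - G / (N * (N - 1)) := by
    split_ifs with hij
    · rw [hij, sum_perm_apply_mul_self, ← hN, ← hG]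
      field
    · rw [sum_perm_apply_mul_apply hg (S.injective.ne hij), sum_perm_apply_mul_self, ← hN, ← hG]
      field
  calc ∑ π : Equiv.Perm α, (∑ j ∈ T, u j * g (π (S j))) ^ 2
    _ = ∑ i ∈ T, ∑ j ∈ T, u i * u j * ∑ π : Equiv.Perm α, g (π (S i)) * g (π (S j)) := by
      simp_rw [sq, Finset.sum_mul_sum, Finset.mul_sum]
      rw [Finset.sum_comm]
      refine Finset.sum_congr rfl fun i _ => Finset.sum_comm.trans ?_
      exact Finset.sum_congr rfl fun j _ => Finset.sum_congr rfl fun π _ => mul_mul_mul_comm ..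
    _ = (∑ j ∈ T, u j ^ 2) * (G / (N - 1)) - (∑ j ∈ T, u j) ^ 2 * (G / (N * (N - 1))) := by
      simp_rw [hmoment, mul_sub, Finset.sum_sub_distrib, mul_ite, mul_zero, Finset.sum_ite_eq,
        sq (∑ j ∈ T, u j), Finset.sum_mul_sum, Finset.sum_mul]
      congr 1
      exact Finset.sum_congr rfl fun i hi => by rw [if_pos hi, sq]
    _ ≤ (∑ j ∈ T, u j ^ 2) * (G / (N - 1)) := sub_le_self _ (by positivity)
    _ = (Fintype.card α)! * ((∑ j ∈ T, u j ^ 2) * (∑ p, g p ^ 2) / (N - 1)) := by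
      rw [hG]
      ring

end Permutations

lemma sum_embedding_sq_le [Fintype β] {g : α → ℝ} (hg : ∑ p, g p = 0)
    (hα : 1 < Fintype.card α) (T : Finset β) (u : β → ℝ) :
    ∑ S : β ↪ α, (∑ j ∈ T, u j * g (S j)) ^ 2 ≤
      Fintype.card (β ↪ α) * ((∑ j ∈ T, u j ^ 2) * (∑ p, g p ^ 2) / (Fintype.card α - 1)) := by
  classical
  have hperm (π : Equiv.Perm α) : ∑ S : β ↪ α, (∑ j ∈ T, u j * g (π (S j))) ^ 2 =
      ∑ S : β ↪ α, (∑ j ∈ T, u j * g (S j)) ^ 2 :=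
    Fintype.sum_equiv (Equiv.embeddingCongr (Equiv.refl β) π) _ _ fun S => by
      simp [Equiv.embeddingCongr]
  refine le_of_mul_le_mul_left ?_ (by positivity : (0 : ℝ) < (Fintype.card α)!)
  calc (Fintype.card α)! * ∑ S : β ↪ α, (∑ j ∈ T, u j * g (S j)) ^ 2
    _ = ∑ π : Equiv.Perm α, ∑ S : β ↪ α, (∑ j ∈ T, u j * g (π (S j))) ^ 2 := by
      simp_rw [hperm]
      rw [Finset.sum_const, Finset.card_univ, Fintype.card_perm, nsmul_eq_mul]
    _ = ∑ S : β ↪ α, ∑ π : Equiv.Perm α, (∑ j ∈ T, u j * g (π (S j))) ^ 2 := Finset.sum_comm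
    _ ≤ ∑ _S : β ↪ α, (Fintype.card α)! *
          ((∑ j ∈ T, u j ^ 2) * (∑ p, g p ^ 2) / (Fintype.card α - 1)) :=
      Finset.sum_le_sum fun S _ => sum_perm_sq_le hg hα T u S
    _ = _ := by
      rw [Finset.sum_const, Finset.card_univ, nsmul_eq_mul, mul_left_comm]

lemma sum_sub_mean_eq_zero (a : α → ℝ) : ∑ p, (a p - (∑ q, a q) / Fintype.card α) = 0 := by
  rcases isEmpty_or_nonempty α with h | h
  · simp
  · rw [Finset.sum_sub_distrib, Finset.sum_const, Finset.card_univ, nsmul_eq_mul,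
      mul_div_cancel₀ _ (by simp), sub_self]

lemma sum_sub_mean_sq_le (a : α → ℝ) :
    ∑ p, (a p - (∑ q, a q) / Fintype.card α) ^ 2 ≤ ∑ p, a p ^ 2 := by
  set μ := (∑ q, a q) / Fintype.card α with hμ
  calc ∑ p, (a p - μ) ^ 2
    _ ≤ ∑ p, (a p - μ) ^ 2 + ∑ _p : α, μ ^ 2 := le_add_of_nonneg_right (by positivity)
    _ = ∑ p, a p ^ 2 - 2 * μ * ∑ p, (a p - μ) := by
      rw [Finset.mul_sum, ← Finset.sum_add_distrib, ← Finset.sum_sub_distrib]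
      exact Finset.sum_congr rfl fun p _ => by ring
    _ = ∑ p, a p ^ 2 := by rw [hμ, sum_sub_mean_eq_zero, mul_zero, sub_zero]

lemma sum_embedding_centered_sq_le [Fintype β] (hα : 1 < Fintype.card α) (a : α → ℝ)
    (T : Finset β) (u : β → ℝ) :
    ∑ S : β ↪ α, (∑ j ∈ T, u j * (a (S j) - (∑ q, a q) / Fintype.card α)) ^ 2 ≤
      Fintype.card (β ↪ α) * ((∑ j ∈ T, u j ^ 2) * (∑ p, a p ^ 2) / (Fintype.card α - 1)) := by
  have hα' : (0 : ℝ) ≤ Fintype.card α - 1 := sub_nonneg.2 (by exact_mod_cast hα.le)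
  refine (sum_embedding_sq_le (sum_sub_mean_eq_zero a) hα T u).trans ?_
  gcongr _ * (_ * ?_ / _)
  exact sum_sub_mean_sq_le a

end SamplingWithoutReplacement

section ErrorProbability

variable {k l n m : ℕ} {vz : ℝ≥0}

/-- `P{d(A, A X + Z) ≠ supp X}` for a random measurement matrix `A` of law `μ`, over the randomness
of the independent `S`, `A` and `Z`. The Gaussian and the fixed measurement matrices are those of
laws `gaussianMatrix n m va` and `Measure.dirac A`. -/
noncomputable def errorProb (vz : ℝ≥0) (W : Matrix (Fin k) (Fin l) ℝ)
    (μ : Measure (Matrix (Fin n) (Fin m) ℝ))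
    (d : Matrix (Fin n) (Fin m) ℝ → Matrix (Fin n) (Fin l) ℝ → Set (Fin m)) : ℝ :=
  ((locationLaw k m).prod (μ.prod (gaussianMatrix n l vz))).real
    {ω | d ω.2.1 (ω.2.1 * signal W ω.1 + ω.2.2) ≠ supp (signal W ω.1)}

instance : DiscreteMeasurableSpace (Fin k ↪ Fin m) :=
  ⟨fun _ => MeasurableSpace.measurableSet_top⟩

instance : IsZeroOrProbabilityMeasure (locationLaw k m) :=
  inferInstanceAs (IsZeroOrProbabilityMeasure (cond _ _))

lemma isProbabilityMeasure_locationLaw (hkm : k ≤ m) : IsProbabilityMeasure (locationLaw k m) :=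
  have : Nonempty (Fin k ↪ Fin m) := ⟨Fin.castLEEmb hkm⟩
  isProbabilityMeasure_uniformOn Set.finite_univ Set.univ_nonempty

lemma errorProb_le_one (hkm : k ≤ m) (W : Matrix (Fin k) (Fin l) ℝ)
    (μ : Measure (Matrix (Fin n) (Fin m) ℝ)) [IsProbabilityMeasure μ]
    (d : Matrix (Fin n) (Fin m) ℝ → Matrix (Fin n) (Fin l) ℝ → Set (Fin m)) :
    errorProb vz W μ d ≤ 1 :=
  have := isProbabilityMeasure_locationLaw hkm
  measureReal_le_one

lemma integral_locationLaw (f : (Fin k ↪ Fin m) → ℝ) :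
    ∫ S, f S ∂locationLaw k m = (∑ S, f S) / Fintype.card (Fin k ↪ Fin m) := by
  rw [locationLaw, uniformOn, ProbabilityTheory.cond, Measure.restrict_univ, integral_smul_measure,
    integral_count, Measure.count_univ, ENat.card_eq_coe_fintype_card, div_eq_inv_mul]
  simp

lemma measureReal_prod_eq_integral {Ω Ω' : Type*} [MeasurableSpace Ω] [MeasurableSpace Ω']
    (μ : Measure Ω) (ν : Measure Ω') [IsFiniteMeasure ν] {E : Set (Ω × Ω')}
    (hE : MeasurableSet E) : (μ.prod ν).real E = ∫ ω, ν.real (Prod.mk ω ⁻¹' E) ∂μ := by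
  rw [measureReal_def, Measure.prod_apply hE, ← integral_toReal]
  · rfl
  · exact (measurable_measure_prodMk_left hE).aemeasurable
  · exact ae_of_all _ fun ω => measure_lt_top _ _

lemma signal_apply (W : Matrix (Fin k) (Fin l) ℝ) (S : Fin k ↪ Fin m) (j : Fin k) :
    signal W S (S j) = W j := by
  ext i
  simp [signal, S.injective.eq_iff]

lemma supp_signal {W : Matrix (Fin k) (Fin l) ℝ} (hW : ∀ i, ∃ j, W i j ≠ 0)
    (S : Fin k ↪ Fin m) : supp (signal W S) = Set.range S := by
  ext s
  constructor
  · rintro ⟨i, hi⟩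
    by_contra hs
    exact hi (Finset.sum_eq_zero fun j _ => if_neg fun h => hs ⟨j, h.symm⟩)
  · rintro ⟨j, rfl⟩
    obtain ⟨i, hi⟩ := hW j
    exact ⟨i, by rwa [signal_apply]⟩

lemma mul_signal_apply (W : Matrix (Fin k) (Fin l) ℝ) (S : Fin k ↪ Fin m)
    (A : Matrix (Fin n) (Fin m) ℝ) (i : Fin n) (r : Fin l) :
    (A * signal W S) i r = ∑ j, A i (S j) * W j r := by
  simp only [mul_apply, signal, Finset.mul_sum, mul_ite, mul_zero]
  rw [Finset.sum_comm]
  simp only [Finset.sum_ite_eq', Finset.mem_univ, if_true]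

lemma signal_mul (W : Matrix (Fin k) (Fin l) ℝ) (U : Matrix (Fin l) (Fin l) ℝ)
    (S : Fin k ↪ Fin m) : signal (W * U) S = signal W S * U := by
  ext s r
  simp only [signal, mul_apply, Finset.sum_mul, ite_mul, zero_mul]
  rw [Finset.sum_comm]
  refine Finset.sum_congr rfl fun j _ => ?_
  split_ifs
  · rfl
  · exact Finset.sum_const_zero.symm

lemma supp_mul_orthogonal {U : Matrix (Fin l) (Fin l) ℝ} (hU : U ∈ orthogonalGroup (Fin l) ℝ)
    (X : Matrix (Fin m) (Fin l) ℝ) : supp (X * U) = supp X := by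
  have hinj : Function.Injective fun x => x ᵥ* U :=
    vecMul_injective_iff_isUnit.2 (Unitary.isUnit_coe (U := ⟨U, hU⟩))
  ext s
  refine Function.ne_iff.symm.trans (Iff.trans ?_ Function.ne_iff)
  rw [show (X * U) s = X s ᵥ* U from rfl]
  exact hinj.ne_iff' (zero_vecMul U)

variable {d : Matrix (Fin n) (Fin m) ℝ → Matrix (Fin n) (Fin l) ℝ → Set (Fin m)}

lemma measurable_observation (X : Matrix (Fin m) (Fin l) ℝ) :
    Measurable fun ω : Matrix (Fin n) (Fin m) ℝ × Matrix (Fin n) (Fin l) ℝ =>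
      (ω.1, ω.1 * X + ω.2) := by
  have h : Measurable fun ω : (Fin n → Fin m → ℝ) × (Fin n → Fin l → ℝ) =>
      (ω.1, fun i c => (∑ p, ω.1 i p * X p c) + ω.2 i c) := by fun_prop
  exact h

lemma measurableSet_recovery_eq (hd : Measurable (Function.uncurry d))
    (X : Matrix (Fin m) (Fin l) ℝ) (B : Set (Fin m)) :
    MeasurableSet {ω : Matrix (Fin n) (Fin m) ℝ × Matrix (Fin n) (Fin l) ℝ |
      d ω.1 (ω.1 * X + ω.2) = B} :=
  (hd.comp (measurable_observation X)) (measurableSet_singleton B)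

lemma measurableSet_success (hd : Measurable (Function.uncurry d))
    (W : Matrix (Fin k) (Fin l) ℝ) :
    MeasurableSet {ω : (Fin k ↪ Fin m) × Matrix (Fin n) (Fin m) ℝ × Matrix (Fin n) (Fin l) ℝ |
      d ω.2.1 (ω.2.1 * signal W ω.1 + ω.2.2) = supp (signal W ω.1)} :=
  measurableSet_setOfPred.2 <| measurable_from_prod_countable_right fun S =>
    measurableSet_setOfPred.1 (measurableSet_recovery_eq hd (signal W S) (supp (signal W S)))

lemma errorProb_gaussianMatrix (va : ℝ≥0) (W : Matrix (Fin k) (Fin l) ℝ) :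
    errorProb vz W (gaussianMatrix n m va) d = errorProbGaussian va vz W d :=
  rfl

lemma errorProb_dirac (W : Matrix (Fin k) (Fin l) ℝ) (A : Matrix (Fin n) (Fin m) ℝ)
    {d : Matrix (Fin n) (Fin l) ℝ → Set (Fin m)} (hd : Measurable d) :
    errorProb vz W (Measure.dirac A) (fun _ => d) = errorProbFixed vz W A d := by
  have hmap : (locationLaw k m).prod ((Measure.dirac A).prod (gaussianMatrix n l vz)) =
      ((locationLaw k m).prod (gaussianMatrix n l vz)).map (Prod.map id (Prod.mk A)) := by
    rw [Measure.dirac_prod, ← Measure.map_prod_map _ _ measurable_id measurable_prodMk_left,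
      Measure.map_id]
  have hd' : Measurable (Function.uncurry fun _ : Matrix (Fin n) (Fin m) ℝ => d) :=
    hd.comp measurable_snd
  rw [errorProb, hmap]
  exact map_measureReal_apply (by fun_prop) (measurableSet_success hd' W).compl

lemma integrable_measureReal_recovery_eq (μ : Measure (Matrix (Fin n) (Fin m) ℝ))
    [IsFiniteMeasure μ] (hd : Measurable (Function.uncurry d)) (X : Matrix (Fin m) (Fin l) ℝ)
    (B : Set (Fin m)) :
    Integrable (fun A => (gaussianMatrix n l vz).real {z | d A (A * X + z) = B}) μ := by
  refine Integrable.of_bound (measurable_measure_prodMk_left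
    (measurableSet_recovery_eq hd X B)).ennreal_toReal.aestronglyMeasurable 1
    (ae_of_all _ fun A => ?_)
  rw [Real.norm_of_nonneg measureReal_nonneg]
  exact measureReal_le_one

lemma one_sub_errorProb_eq (hkm : k ≤ m) {W : Matrix (Fin k) (Fin l) ℝ}
    (hW : ∀ i, ∃ j, W i j ≠ 0) (μ : Measure (Matrix (Fin n) (Fin m) ℝ)) [IsProbabilityMeasure μ]
    (hd : Measurable (Function.uncurry d)) :
    1 - errorProb vz W μ d =
      (∑ S : Fin k ↪ Fin m, ∫ A, (gaussianMatrix n l vz).real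
        {z | d A (A * signal W S + z) = Set.range S} ∂μ) / Fintype.card (Fin k ↪ Fin m) := by
  have := isProbabilityMeasure_locationLaw hkm
  have hsucc := measurableSet_success hd W
  rw [errorProb, ← Set.compl_ofPred, ← probReal_compl_eq_one_sub hsucc.compl, compl_compl,
    measureReal_prod_eq_integral _ _ hsucc, integral_locationLaw]
  congr 1
  refine Finset.sum_congr rfl fun S _ => ?_
  rw [measureReal_prod_eq_integral _ _ (measurable_prodMk_left hsucc)]
  simp only [Set.preimage_ofPred_eq, supp_signal hW]

lemma measurable_mul_const (B : Matrix (Fin l) (Fin l) ℝ) :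
    Measurable fun Y : Matrix (Fin n) (Fin l) ℝ => Y * B := by
  have h : Measurable fun (Y : Fin n → Fin l → ℝ) i r => ∑ p, Y i p * B p r := by fun_prop
  exact h

lemma measurable_uncurry_mul_const (hd : Measurable (Function.uncurry d))
    (B : Matrix (Fin l) (Fin l) ℝ) :
    Measurable (Function.uncurry fun (A : Matrix (Fin n) (Fin m) ℝ)
      (Y : Matrix (Fin n) (Fin l) ℝ) => d A (Y * B)) :=
  hd.comp (measurable_fst.prodMk ((measurable_mul_const B).comp measurable_snd))

lemma errorProb_mul_orthogonal {U : Matrix (Fin l) (Fin l) ℝ}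
    (hU : U ∈ orthogonalGroup (Fin l) ℝ) (W : Matrix (Fin k) (Fin l) ℝ)
    (μ : Measure (Matrix (Fin n) (Fin m) ℝ)) [IsProbabilityMeasure μ]
    (hd : Measurable (Function.uncurry d)) :
    errorProb vz (W * U) μ (fun A Y => d A (Y * Uᵀ)) = errorProb vz W μ d := by
  have hrotate : MeasurePreserving (fun Z : Matrix (Fin n) (Fin l) ℝ => Z * U)
      (gaussianMatrix n l vz) (gaussianMatrix n l vz) :=
    ⟨measurable_mul_const U, map_mul_gaussianMatrix hU vz⟩
  have hpres := (MeasurePreserving.id (locationLaw k m)).prod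
    ((MeasurePreserving.id μ).prod hrotate)
  have hUU : U * Uᵀ = 1 := (mem_orthogonalGroup_iff (Fin l) ℝ).1 hU
  have hsucc := measurableSet_success (measurable_uncurry_mul_const hd Uᵀ) (W * U)
  refine (hpres.measureReal_preimage hsucc.compl.nullMeasurableSet).symm.trans
    (congrArg (Measure.real _) ?_)
  ext ⟨S, A, Z⟩
  simp only [Set.mem_preimage, Set.mem_ofPred_eq, Prod.map_apply, id_eq, signal_mul,
    Set.mem_compl_iff, supp_mul_orthogonal hU, ← Matrix.mul_assoc, ← Matrix.add_mul]
  rw [Matrix.mul_assoc, hUU, Matrix.mul_one]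

end ErrorProbability

section ColumnBound

open scoped Nat Finset

variable {k l n m : ℕ} {va vz : ℝ≥0}

/-- The mean of the measurements `A X + Z` for a genie-aided receiver which knows the locations
`S j`, `j ∉ T`, and averages over the locations `S j`, `j ∈ T`: in place of the column `S j` of `A`
it uses the mean of all columns. -/
noncomputable def genieMean (W : Matrix (Fin k) (Fin l) ℝ) (T : Finset (Fin k))
    (A : Matrix (Fin n) (Fin m) ℝ) (S : Fin k ↪ Fin m) : Matrix (Fin n) (Fin l) ℝ :=
  fun i r => ∑ j ∈ Tᶜ, A i (S j) * W j r + ∑ j ∈ T, (∑ p, A i p) / m * W j r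

/-- The total gain `‖W_T e_r‖²` with which the rows of `W` indexed by `T` enter the measurements in
column `r`. -/
def columnGain (W : Matrix (Fin k) (Fin l) ℝ) (T : Finset (Fin k)) (r : Fin l) : ℝ≥0 :=
  ∑ j ∈ T, ‖W j r‖₊ ^ 2

/-- The variance of a measurement in column `r` for a genie-aided receiver which knows the
locations `S j`, `j ∉ T`: that of the noise plus that of the contribution of the rows in `T`. -/
def columnVariance (va vz : ℝ≥0) (W : Matrix (Fin k) (Fin l) ℝ) (T : Finset (Fin k))
    (r : Fin l) : ℝ≥0 :=
  vz + va * columnGain W T r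

lemma coe_columnGain (W : Matrix (Fin k) (Fin l) ℝ) (T : Finset (Fin k)) (r : Fin l) :
    (columnGain W T r : ℝ) = ∑ j ∈ T, W j r ^ 2 := by
  simp [columnGain]

lemma columnVariance_pos (hvz : 0 < vz) (W : Matrix (Fin k) (Fin l) ℝ) (T : Finset (Fin k))
    (r : Fin l) : 0 < columnVariance va vz W T r :=
  add_pos_of_pos_of_nonneg hvz zero_le

variable (W : Matrix (Fin k) (Fin l) ℝ) (T : Finset (Fin k)) (A : Matrix (Fin n) (Fin m) ℝ)

lemma genieMean_congr {S S' : Fin k ↪ Fin m} (h : ∀ j ∉ T, S' j = S j) :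
    genieMean W T A S' = genieMean W T A S := by
  ext i r
  refine congrArg (· + _) (Finset.sum_congr rfl fun j hj => ?_)
  rw [h j (Finset.mem_compl.1 hj)]

lemma mul_signal_sub_genieMean (S : Fin k ↪ Fin m) (i : Fin n) (r : Fin l) :
    (A * signal W S) i r - genieMean W T A S i r =
      ∑ j ∈ T, W j r * (A i (S j) - (∑ p, A i p) / Fintype.card (Fin m)) := by
  rw [mul_signal_apply, genieMean, ← T.sum_compl_add_sum, add_sub_add_left_eq_sub,
    ← Finset.sum_sub_distrib, Fintype.card_fin]
  exact Finset.sum_congr rfl fun j _ => by ring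

lemma sum_sq_eq_mul_avgPower : ∑ i, ∑ p, A i p ^ 2 = n * m * avgPower A := by
  rcases n.eq_zero_or_pos with rfl | hn
  · simp
  rcases m.eq_zero_or_pos with rfl | hm
  · simp
  rw [avgPower, mul_div_cancel₀ _ (by positivity)]

lemma vz_div_columnVariance_sub_one (hvz : 0 < vz) (r : Fin l) :
    (vz : ℝ) / columnVariance va vz W T r - 1 =
      -(columnGain W T r / columnVariance va vz W T r * va) := by
  have hV : (columnVariance va vz W T r : ℝ) ≠ 0 :=
    NNReal.coe_ne_zero.2 (columnVariance_pos hvz W T r).ne'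
  have hVr : (columnVariance va vz W T r : ℝ) = vz + va * columnGain W T r := by
    simp [columnVariance]
  rw [div_sub_one hV]
  nth_rw 1 [hVr]
  ring

lemma sum_entry_klDiv_genie_le (hvz : 0 < vz) (hm : 1 < m) (a : Fin m → ℝ) (r : Fin l) :
    ∑ S : Fin k ↪ Fin m, (Real.log (columnVariance va vz W T r / vz) +
      vz / columnVariance va vz W T r - 1 +
        (∑ j ∈ T, W j r * (a (S j) - (∑ p, a p) / Fintype.card (Fin m))) ^ 2 /
          columnVariance va vz W T r) / 2 ≤
      Fintype.card (Fin k ↪ Fin m) * ((Real.log (columnVariance va vz W T r / vz) +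
        columnGain W T r / columnVariance va vz W T r * ((∑ p, a p ^ 2) / (m - 1) - va)) / 2) := by
  have hV : (0 : ℝ) < columnVariance va vz W T r := columnVariance_pos hvz W T r
  have hsq := sum_embedding_centered_sq_le (β := Fin k) (α := Fin m)
    (by rwa [Fintype.card_fin]) a T fun j => W j r
  rw [← Finset.sum_div, Finset.sum_add_distrib, ← Finset.sum_div]
  simp only [add_sub_assoc, vz_div_columnVariance_sub_one W T hvz, Finset.sum_const,
    Finset.card_univ, nsmul_eq_mul]
  refine (div_le_div_of_nonneg_right (add_le_add_right
    (div_le_div_of_nonneg_right hsq hV.le) _) zero_le_two).trans_eq ?_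
  rw [← coe_columnGain, Fintype.card_fin m]
  ring

lemma sum_klDiv_genie_le (hvz : 0 < vz) (hm : 1 < m) :
    ∑ S : Fin k ↪ Fin m, (klDiv (gaussianEntries (A * signal W S) fun _ => vz)
        (gaussianEntries (genieMean W T A S) (columnVariance va vz W T))).toReal ≤
      Fintype.card (Fin k ↪ Fin m) * (n / 2 * (∑ r, Real.log (columnVariance va vz W T r / vz) +
        (∑ r, (columnGain W T r / columnVariance va vz W T r : ℝ)) *
          (m / (m - 1) * avgPower A - va))) := by
  simp_rw [toReal_klDiv_gaussianEntries _ _ (fun _ => hvz.ne')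
    fun r => (columnVariance_pos hvz W T r).ne', mul_signal_sub_genieMean]
  rw [Finset.sum_comm]
  simp_rw [Finset.sum_comm (s := (Finset.univ : Finset (Fin k ↪ Fin m)))]
  refine (Finset.sum_le_sum fun i _ => Finset.sum_le_sum fun r _ =>
    sum_entry_klDiv_genie_le W T hvz hm (A i) r).trans_eq ?_
  simp_rw [← Finset.mul_sum]
  rw [Finset.sum_comm]
  congr 1
  rw [Finset.sum_mul, ← Finset.sum_add_distrib, Finset.mul_sum]
  refine Finset.sum_congr rfl fun r _ => ?_
  rw [← Finset.sum_div, Finset.sum_add_distrib, ← Finset.mul_sum, Finset.sum_sub_distrib,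
    ← Finset.sum_div, sum_sq_eq_mul_avgPower]
  simp only [Finset.sum_const, Finset.card_univ, Fintype.card_fin, nsmul_eq_mul]
  ring

lemma log_mul_sum_measureReal_recovery_le (hvz : 0 < vz) (hm : 1 < m)
    {d : Matrix (Fin n) (Fin l) ℝ → Set (Fin m)} (hd : Measurable d) :
    Real.log (((m - k + 1 : ℕ) : ℝ) ^ #T / k !) * ∑ S : Fin k ↪ Fin m,
        (gaussianMatrix n l vz).real {z | d (A * signal W S + z) = Set.range S} ≤
      Fintype.card (Fin k ↪ Fin m) *
        (1 + n / 2 * (∑ r, Real.log (columnVariance va vz W T r / vz) +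
          (∑ r, (columnGain W T r / columnVariance va vz W T r : ℝ)) *
            (m / (m - 1) * avgPower A - va))) := by
  have hfano := log_mul_sum_measureReal_eq_range_le T
    (P := fun S : Fin k ↪ Fin m => gaussianEntries (A * signal W S) fun _ => vz)
    (Q := fun S => gaussianEntries (genieMean W T A S) (columnVariance va vz W T))
    (fun S => klDiv_gaussianEntries_ne_top _ _ (fun _ => hvz.ne')
      fun r => (columnVariance_pos hvz W T r).ne')
    (fun S S' h => by rw [genieMean_congr W T A h]) hd
  have hshift (S : Fin k ↪ Fin m) :
      (gaussianEntries (A * signal W S) fun _ => vz).real {Y | d Y = Set.range S} =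
        (gaussianMatrix n l vz).real {z | d (A * signal W S + z) = Set.range S} := by
    rw [← map_const_add_gaussianMatrix]
    exact map_measureReal_apply (measurable_const_add (M := Fin n → Fin l → ℝ) _)
      (hd (measurableSet_singleton _))
  simp only [hshift, Fintype.card_fin] at hfano
  linarith [sum_klDiv_genie_le (va := va) W T A hvz hm]

lemma sum_columnGain_div_mul_le (hvz : 0 < vz) (hm : 1 < m) {P : ℝ} (hP : P ≤ va) :
    (∑ r, (columnGain W T r / columnVariance va vz W T r : ℝ)) * (m / (m - 1) * P - va) ≤
      l / (m - 1) := by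
  have hm' : (0 : ℝ) < m - 1 := sub_pos.2 (by exact_mod_cast hm)
  have hexcess : m / (m - 1) * P - va ≤ va / (m - 1) := by
    calc m / (m - 1) * P - va ≤ m / (m - 1) * va - va := by gcongr
      _ = va / (m - 1) := by field_simp; ring
  have hratio (r : Fin l) : (columnGain W T r / columnVariance va vz W T r : ℝ) * va ≤ 1 := by
    linarith [vz_div_columnVariance_sub_one (va := va) W T hvz r,
      show (0 : ℝ) ≤ vz / columnVariance va vz W T r by positivity]
  calc
    _ ≤ (∑ r, (columnGain W T r / columnVariance va vz W T r : ℝ)) * (va / (m - 1)) := by gcongr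
    _ = (∑ r, (columnGain W T r / columnVariance va vz W T r : ℝ) * va) / (m - 1) := by
      rw [← Finset.sum_mul, mul_div_assoc]
    _ ≤ l / (m - 1) := by
      gcongr
      simpa using Finset.sum_le_sum fun r (_ : r ∈ Finset.univ) => hratio r

variable {d : Matrix (Fin n) (Fin m) ℝ → Matrix (Fin n) (Fin l) ℝ → Set (Fin m)}
  {μ : Measure (Matrix (Fin n) (Fin m) ℝ)} [IsProbabilityMeasure μ]

lemma log_mul_one_sub_errorProb_le_sum_log (hkm : k ≤ m) (hm : 1 < m) (hvz : 0 < vz)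
    (hW : ∀ i, ∃ j, W i j ≠ 0) (hd : Measurable (Function.uncurry d))
    (hμ : Integrable avgPower μ) (hpower : ∫ A, avgPower A ∂μ ≤ va) :
    Real.log (((m - k + 1 : ℕ) : ℝ) ^ #T / k !) * (1 - errorProb vz W μ d) ≤
      1 + n / 2 * (∑ r, Real.log (columnVariance va vz W T r / vz) + l / (m - 1)) := by
  have : Nonempty (Fin k ↪ Fin m) := ⟨Fin.castLEEmb hkm⟩
  have hcard : (0 : ℝ) < Fintype.card (Fin k ↪ Fin m) := by exact_mod_cast Fintype.card_pos
  have hsuccess S := integrable_measureReal_recovery_eq (vz := vz) μ hd (signal W S) (Set.range S)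
  set L := ∑ r, Real.log (columnVariance va vz W T r / vz)
  set ρ := ∑ r, (columnGain W T r / columnVariance va vz W T r : ℝ)
  have hexcess : Integrable (fun A => m / (m - 1) * avgPower A - va) μ :=
    (hμ.const_mul _).sub (integrable_const _)
  have hbound : Integrable (fun A => 1 + n / 2 * (L + ρ * (m / (m - 1) * avgPower A - va))) μ :=
    (integrable_const _).fun_add (((integrable_const _).fun_add (hexcess.const_mul _)).const_mul _)
  rw [one_sub_errorProb_eq hkm hW μ hd, ← mul_div_assoc, div_le_iff₀' hcard]
  calc
    _ = ∫ A, Real.log (((m - k + 1 : ℕ) : ℝ) ^ #T / k !) * ∑ S : Fin k ↪ Fin m,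
        (gaussianMatrix n l vz).real {z | d A (A * signal W S + z) = Set.range S} ∂μ := by
      rw [integral_const_mul, integral_finsetSum _ fun S _ => hsuccess S]
    _ ≤ ∫ A, Fintype.card (Fin k ↪ Fin m) *
        (1 + n / 2 * (L + ρ * (m / (m - 1) * avgPower A - va))) ∂μ :=
      integral_mono ((integrable_finsetSum _ fun S _ => hsuccess S).const_mul _)
        (hbound.const_mul _) fun A =>
          log_mul_sum_measureReal_recovery_le W T A hvz hm hd.of_uncurry_left
    _ = Fintype.card (Fin k ↪ Fin m) *
        (1 + n / 2 * (L + ρ * (m / (m - 1) * ∫ A, avgPower A ∂μ - va))) := by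
      rw [integral_const_mul, integral_add (integrable_const _) (((integrable_const _).fun_add
          (hexcess.const_mul _)).const_mul _), integral_const_mul,
        integral_add (integrable_const _) (hexcess.const_mul _), integral_const_mul,
        integral_sub (hμ.const_mul _) (integrable_const _), integral_const_mul]
      simp only [integral_const, probReal_univ, one_smul]
    _ ≤ _ := by
      gcongr
      exact sum_columnGain_div_mul_le W T hvz hm hpower

end ColumnBound

section Rotation

open scoped Nat Finset

variable {k l n m : ℕ} {va vz : ℝ≥0} (W : Matrix (Fin k) (Fin l) ℝ) (T : Finset (Fin k))

/-- The Gram matrix `W_Tᵀ W_T` of the columns of the rows of `W` indexed by `T`. -/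
def rowGram : Matrix (Fin l) (Fin l) ℝ :=
  (W.submatrix ((↑) : T → Fin k) id)ᵀ * W.submatrix ((↑) : T → Fin k) id

lemma rowGram_mul (U : Matrix (Fin l) (Fin l) ℝ) :
    rowGram (W * U) T = Uᵀ * rowGram W T * U := by
  have hsub : (W * U).submatrix ((↑) : T → Fin k) id =
      W.submatrix ((↑) : T → Fin k) id * U := rfl
  rw [rowGram, hsub, transpose_mul, rowGram]
  simp only [Matrix.mul_assoc]

lemma coe_columnGain_eq_rowGram (r : Fin l) : (columnGain W T r : ℝ) = rowGram W T r r := by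
  rw [coe_columnGain, rowGram, mul_apply, ← Finset.sum_coe_sort]
  exact Finset.sum_congr rfl fun j _ => pow_two _

lemma exists_orthogonal_rowGram_mul_eq_diagonal :
    ∃ U ∈ orthogonalGroup (Fin l) ℝ, ∃ x, rowGram (W * U) T = diagonal x := by
  have hG : (rowGram W T).IsHermitian := isHermitian_conjTranspose_mul_self _
  refine ⟨hG.eigenvectorUnitary, hG.eigenvectorUnitary.2, hG.eigenvalues, ?_⟩
  have hdiag := hG.conjStarAlgAut_star_eigenvectorUnitary
  rw [Unitary.conjStarAlgAut_star_apply] at hdiag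
  rw [rowGram_mul]
  exact hdiag

variable {W T}

lemma det_one_add_smul_rowGram_mul {U : Matrix (Fin l) (Fin l) ℝ}
    (hU : U ∈ orthogonalGroup (Fin l) ℝ) (c : ℝ) :
    (1 + c • rowGram (W * U) T).det = (1 + c • rowGram W T).det := by
  have hUU : Uᵀ * U = 1 := (mem_orthogonalGroup_iff' (Fin l) ℝ).1 hU
  have hconj : 1 + c • rowGram (W * U) T = Uᵀ * (1 + c • rowGram W T) * U := by
    rw [rowGram_mul, Matrix.mul_add, Matrix.add_mul, Matrix.mul_one, hUU, Matrix.mul_smul,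
      Matrix.smul_mul]
  rw [hconj, det_mul_right_comm, hUU, Matrix.one_mul]

lemma log_det_one_add_smul_rowGram_of_eq_diagonal (hvz : 0 < vz) {x : Fin l → ℝ}
    (hx : rowGram W T = diagonal x) :
    Real.log (1 + ((va : ℝ) / vz) • rowGram W T).det =
      ∑ r, Real.log (columnVariance va vz W T r / vz) := by
  have hvz' : (vz : ℝ) ≠ 0 := NNReal.coe_ne_zero.2 hvz.ne'
  have hentry (r : Fin l) : 1 + (va / vz : ℝ) * x r = columnVariance va vz W T r / vz := by
    have hgain : (columnGain W T r : ℝ) = x r := by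
      rw [coe_columnGain_eq_rowGram, hx, diagonal_apply_eq]
    rw [columnVariance, NNReal.coe_add, NNReal.coe_mul, hgain]
    field_simp
  rw [hx, ← diagonal_one, ← diagonal_smul, diagonal_add, det_diagonal, Real.log_prod]
  · exact Finset.sum_congr rfl fun r _ => congrArg Real.log (hentry r)
  · intro r _
    exact (hentry r).trans_ne
      (div_ne_zero (NNReal.coe_ne_zero.2 (columnVariance_pos hvz W T r).ne') hvz')

variable (va W T)

lemma exists_orthogonal_sum_log_columnVariance_eq (hvz : 0 < vz) :
    ∃ U ∈ orthogonalGroup (Fin l) ℝ, ∑ r, Real.log (columnVariance va vz (W * U) T r / vz) =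
      Real.log (1 + ((va : ℝ) / vz) • rowGram W T).det := by
  obtain ⟨U, hU, x, hx⟩ := exists_orthogonal_rowGram_mul_eq_diagonal W T
  exact ⟨U, hU, by rw [← det_one_add_smul_rowGram_mul hU,
    log_det_one_add_smul_rowGram_of_eq_diagonal hvz hx]⟩

lemma log_det_one_add_smul_rowGram_nonneg (hvz : 0 < vz) :
    0 ≤ Real.log (1 + ((va : ℝ) / vz) • rowGram W T).det := by
  obtain ⟨U, -, hU⟩ := exists_orthogonal_sum_log_columnVariance_eq va W T hvz
  rw [← hU]
  refine Finset.sum_nonneg fun r _ => Real.log_nonneg ((one_le_div (by exact_mod_cast hvz)).2 ?_)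
  exact_mod_cast le_add_right le_rfl

variable {va W} {d : Matrix (Fin n) (Fin m) ℝ → Matrix (Fin n) (Fin l) ℝ → Set (Fin m)}
  {μ : Measure (Matrix (Fin n) (Fin m) ℝ)} [IsProbabilityMeasure μ]

lemma log_mul_one_sub_errorProb_le (hkm : k ≤ m) (hm : 1 < m) (hvz : 0 < vz)
    (hW : ∀ i, ∃ j, W i j ≠ 0) (hd : Measurable (Function.uncurry d))
    (hμ : Integrable avgPower μ) (hpower : ∫ A, avgPower A ∂μ ≤ va) :
    Real.log (((m - k + 1 : ℕ) : ℝ) ^ #T / k !) * (1 - errorProb vz W μ d) ≤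
      1 + n / 2 * (Real.log (1 + ((va : ℝ) / vz) • rowGram W T).det + l / (m - 1)) := by
  obtain ⟨U, hU, hdet⟩ := exists_orthogonal_sum_log_columnVariance_eq va W T hvz
  have hWU : ∀ i, ∃ j, (W * U) i j ≠ 0 := fun i => by
    change i ∈ supp (W * U)
    rw [supp_mul_orthogonal hU]
    exact hW i
  rw [← errorProb_mul_orthogonal hU W μ hd, ← hdet]
  exact log_mul_one_sub_errorProb_le_sum_log (W * U) T hkm hm hvz hWU
    (measurable_uncurry_mul_const hd Uᵀ) hμ hpower

end Rotation

section Asymptotics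

open scoped Nat Finset

lemma tendsto_one_add_mul_div_mul_sub {ι : Type*} {f : Filter ι} {L e : ι → ℝ}
    (hL : Tendsto L f atTop) (he : Tendsto e f (𝓝 0)) (a C : ℝ) {t : ℝ} (ht : t ≠ 0) :
    Tendsto (fun x => (1 + L x * (a + e x)) / (t * L x - C)) f (𝓝 (a / t)) := by
  have hinv : Tendsto (fun x => (L x)⁻¹) f (𝓝 0) := tendsto_inv_atTop_zero.comp hL
  have hlim : Tendsto (fun x => ((L x)⁻¹ + (a + e x)) / (t - C * (L x)⁻¹)) f (𝓝 (a / t)) := by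
    have hden : Tendsto (fun x => t - C * (L x)⁻¹) f (𝓝 t) := by
      simpa using (hinv.const_mul C).const_sub t
    simpa only [zero_add, add_zero] using! (hinv.add (he.const_add a)).div hden ht
  refine hlim.congr' ?_
  filter_upwards [hL.eventually_gt_atTop 0] with x hx
  rw [← mul_div_mul_left _ _ hx.ne']
  field_simp

lemma mul_log_sub_le_log_pow_div_factorial {k m : ℕ} (hkm : 2 * k ≤ m) (hm : 0 < m) (t : ℕ) :
    t * Real.log m - (t * Real.log 2 + Real.log k !) ≤
      Real.log (((m - k + 1 : ℕ) : ℝ) ^ t / k !) := by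
  have hhalf : (m : ℝ) / 2 ≤ (m - k + 1 : ℕ) := by
    rw [div_le_iff₀ two_pos]
    exact_mod_cast (by omega : m ≤ (m - k + 1) * 2)
  calc
    _ = Real.log ((m / 2) ^ t / k !) := by
      rw [Real.log_div (by positivity) (by positivity), Real.log_pow,
        Real.log_div (by positivity) two_ne_zero]
      ring
    _ ≤ _ := by gcongr

lemma exists_pos_eventually_le_of_log_mul_one_sub_le (k : ℕ) {t : ℕ} (ht : 0 < t) {c r D : ℝ}
    (hc : 0 ≤ c) (hcr : c < r) (hD : 0 ≤ D) :
    ∃ η > 0, ∀ᶠ m : ℕ in atTop, ∀ (n : ℕ) (P : ℝ), 0 < n → P ≤ 1 → r < Real.log m / n →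
      Real.log (((m - k + 1 : ℕ) : ℝ) ^ t / k !) * (1 - P) ≤
        1 + n / 2 * (2 * t * c + D / (m - 1)) → η ≤ P := by
  have hr : 0 < r := hc.trans_lt hcr
  have ht' : (0 : ℝ) < t := by exact_mod_cast ht
  have hcr' : c / r < 1 := (div_lt_one hr).2 hcr
  set C := t * Real.log 2 + Real.log k !
  have hlog : Tendsto (fun m : ℕ => Real.log m) atTop atTop :=
    Real.tendsto_log_atTop.comp tendsto_natCast_atTop_atTop
  have hD0 : Tendsto (fun m : ℕ => D / ((m : ℝ) - 1) / (2 * r)) atTop (𝓝 0) := by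
    have hm : Tendsto (fun m : ℕ => (m : ℝ) - 1) atTop atTop :=
      tendsto_atTop_add_const_right _ _ tendsto_natCast_atTop_atTop
    simpa only [zero_div] using (hm.const_div_atTop D).div_const (2 * r)
  have hlim := tendsto_one_add_mul_div_mul_sub hlog hD0 (t * c / r) C ht'.ne'
  have hlt : t * c / r / t < 1 - (1 - c / r) / 2 := by
    rw [mul_div_assoc, mul_div_cancel_left₀ _ ht'.ne']
    linarith
  refine ⟨(1 - c / r) / 2, half_pos (sub_pos.2 hcr'), ?_⟩
  filter_upwards [hlim.eventually_lt_const hlt, eventually_ge_atTop (2 * k), eventually_gt_atTop 1,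
    (hlog.const_mul_atTop ht').eventually_gt_atTop C] with m hlt hkm hm hC n P hn hP hrate hb
  have hn' : (0 : ℝ) < n := by exact_mod_cast hn
  have hm' : (0 : ℝ) < m - 1 := sub_pos.2 (by exact_mod_cast hm)
  have hrn : r * n < Real.log m := (lt_div_iff₀ hn').1 hrate
  have hbound : (t * Real.log m - C) * (1 - P) ≤
      1 + Real.log m * (t * c / r + D / (m - 1) / (2 * r)) := by
    calc
      _ ≤ Real.log (((m - k + 1 : ℕ) : ℝ) ^ t / k !) * (1 - P) :=
        mul_le_mul_of_nonneg_right (mul_log_sub_le_log_pow_div_factorial hkm (by omega) _)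
          (sub_nonneg.2 hP)
      _ ≤ 1 + n / 2 * (2 * t * c + D / (m - 1)) := hb
      _ = 1 + r * n * (t * c / r + D / (m - 1) / (2 * r)) := by field_simp
      _ ≤ _ := by gcongr
  rw [← le_div_iff₀' (sub_pos.2 hC)] at hbound
  linarith

variable {k l : ℕ} {va vz : ℝ≥0}

lemma exists_log_det_eq_mul_capacity (hk : 0 < k) (va vz : ℝ≥0) (W : Matrix (Fin k) (Fin l) ℝ) :
    ∃ T : Finset (Fin k), T.Nonempty ∧
      Real.log (1 + ((va : ℝ) / vz) • rowGram W T).det = 2 * #T * capacity va vz W := by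
  have : Nonempty {T : Finset (Fin k) // T.Nonempty} := ⟨⟨{⟨0, hk⟩}, Finset.singleton_nonempty _⟩⟩
  obtain ⟨T, hT⟩ := exists_eq_ciInf_of_finite (f := fun T : {T : Finset (Fin k) // T.Nonempty} =>
    1 / (2 * (#T.1 : ℝ)) * Real.log (1 + ((va : ℝ) / vz) • rowGram W T.1).det)
  have hcard : (#T.1 : ℝ) ≠ 0 := by exact_mod_cast T.2.card_ne_zero
  refine ⟨T.1, T.2, ?_⟩
  rw [show capacity va vz W = _ from hT.symm]
  field_simp

lemma capacity_nonneg (va : ℝ≥0) (hvz : 0 < vz) (W : Matrix (Fin k) (Fin l) ℝ) :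
    0 ≤ capacity va vz W :=
  Real.iInf_nonneg fun T =>
    mul_nonneg (by positivity) (log_det_one_add_smul_rowGram_nonneg va W T.1 hvz)

lemma exists_pos_eventually_le_errorProb (hk : 0 < k) (hvz : 0 < vz)
    {W : Matrix (Fin k) (Fin l) ℝ} (hW : ∀ i, ∃ j, W i j ≠ 0) {r : ℝ}
    (hr : capacity va vz W < r) :
    ∃ η > 0, ∀ᶠ m : ℕ in atTop, ∀ n : ℕ, 0 < n → r < Real.log m / n →
      ∀ (μ : Measure (Matrix (Fin n) (Fin m) ℝ)) [IsProbabilityMeasure μ],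
        Integrable avgPower μ → ∫ A, avgPower A ∂μ ≤ va →
          ∀ d : Matrix (Fin n) (Fin m) ℝ → Matrix (Fin n) (Fin l) ℝ → Set (Fin m),
            Measurable (Function.uncurry d) → η ≤ errorProb vz W μ d := by
  obtain ⟨T, hT, hdet⟩ := exists_log_det_eq_mul_capacity hk va vz W
  obtain ⟨η, hη, hev⟩ := exists_pos_eventually_le_of_log_mul_one_sub_le k hT.card_pos
    (capacity_nonneg va hvz W) hr (Nat.cast_nonneg l)
  refine ⟨η, hη, ?_⟩
  filter_upwards [hev, eventually_ge_atTop k, eventually_gt_atTop 1]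
    with m hm hkm hm1 n hn hrate μ _ hμ hpower d hd
  refine hm n _ hn (errorProb_le_one hkm W μ d) hrate ?_
  rw [← hdet]
  exact log_mul_one_sub_errorProb_le T hkm hm1 hvz hW hd hμ hpower

end Asymptotics

section AveragePower

variable {n m : ℕ} {va : ℝ≥0}

lemma measurable_avgPower : Measurable (avgPower : Matrix (Fin n) (Fin m) ℝ → ℝ) := by
  have h : Measurable fun A : Fin n → Fin m → ℝ =>
      (∑ i, ∑ p, A i p ^ 2) / ((n : ℝ) * (m : ℝ)) := by
    fun_prop
  exact h

lemma integrable_sq_entry_gaussianMatrix (i : Fin n) (p : Fin m) :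
    Integrable (fun A => A i p ^ 2) (gaussianMatrix n m va) := by
  have hsq : Integrable (fun x : ℝ => x ^ 2) (gaussianReal 0 va) := by
    simpa only [sub_zero] using integrable_sq_sub_gaussianReal (v := va) 0 0
  exact integrable_comp_eval (μ := fun _ : Fin n => Measure.pi fun _ : Fin m => gaussianReal 0 va)
    (integrable_comp_eval (i := p) hsq)

lemma integral_sq_entry_gaussianMatrix (i : Fin n) (p : Fin m) :
    ∫ A, A i p ^ 2 ∂gaussianMatrix n m va = va := by
  have hsq : ∫ x, x ^ 2 ∂gaussianReal 0 va = va := by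
    simpa using integral_sq_sub_gaussianReal (v := va) 0 0
  have hrow : ∫ a : Fin m → ℝ, a p ^ 2 ∂Measure.pi (fun _ => gaussianReal 0 va) = va :=
    (integral_comp_eval (μ := fun _ : Fin m => gaussianReal 0 va) (i := p)
      (f := fun x : ℝ => x ^ 2) (by fun_prop)).trans hsq
  exact (integral_comp_eval (μ := fun _ : Fin n => Measure.pi fun _ : Fin m => gaussianReal 0 va)
    (f := fun a : Fin m → ℝ => a p ^ 2)
    ((measurable_pi_apply p).pow_const 2).aestronglyMeasurable).trans hrow

lemma integrable_avgPower_gaussianMatrix : Integrable avgPower (gaussianMatrix n m va) :=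
  (integrable_finsetSum _ fun i _ => integrable_finsetSum _ fun p _ =>
    integrable_sq_entry_gaussianMatrix i p).div_const _

lemma integral_avgPower_gaussianMatrix_le : ∫ A, avgPower A ∂gaussianMatrix n m va ≤ va := by
  have hrow (i : Fin n) : Integrable (fun A => ∑ p, A i p ^ 2) (gaussianMatrix n m va) :=
    integrable_finsetSum _ fun p _ => integrable_sq_entry_gaussianMatrix i p
  have hsum : ∫ A, (∑ i, ∑ p, A i p ^ 2) ∂gaussianMatrix n m va = va * (n * m) := by
    rw [integral_finsetSum _ fun i _ => hrow i]
    simp_rw [integral_finsetSum _ fun p _ => integrable_sq_entry_gaussianMatrix _ p,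
      integral_sq_entry_gaussianMatrix]
    simp only [Finset.sum_const, Finset.card_univ, Fintype.card_fin, nsmul_eq_mul]
    ring
  simp only [avgPower]
  rw [integral_div, hsum]
  exact div_le_of_le_mul₀ (by positivity) (by positivity) le_rfl

lemma integrable_avgPower_dirac (A : Matrix (Fin n) (Fin m) ℝ) :
    Integrable avgPower (Measure.dirac A) :=
  integrable_dirac' measurable_avgPower.stronglyMeasurable (by simp)

lemma integral_avgPower_dirac (A : Matrix (Fin n) (Fin m) ℝ) :
    ∫ B, avgPower B ∂Measure.dirac A = avgPower A :=
  integral_dirac' _ _ measurable_avgPower.stronglyMeasurable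

end AveragePower

end SupportRecovery

open SupportRecovery in
theorem theorem2_general {k l : ℕ} (hk : 0 < k) (va vz : ℝ≥0) (hvz : 0 < vz)
    (W : Matrix (Fin k) (Fin l) ℝ) (hW : ∀ i, ∃ j, W i j ≠ 0)
    (n : ℕ → ℕ) (hn : ∀ m, k ≤ m → 0 < n m)
    (μ : ∀ m, Measure (Matrix (Fin (n m)) (Fin m) ℝ)) [∀ m, IsProbabilityMeasure (μ m)]
    (hμ : ∀ m, k ≤ m → Integrable avgPower (μ m))
    (hpower : ∀ m, k ≤ m → ∫ A, avgPower A ∂μ m ≤ va)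
    (d : ∀ m, Matrix (Fin (n m)) (Fin m) ℝ → Matrix (Fin (n m)) (Fin l) ℝ → Set (Fin m))
    (hd : ∀ m, Measurable (Function.uncurry (d m))) :
    ((capacity va vz W : EReal) < limsup (rate n) atTop →
      0 < limsup (fun m => errorProb vz W (μ m) (d m)) atTop) ∧
    (∀ φ : ℕ → ℕ, StrictMono φ →
      (capacity va vz W : EReal) < liminf (fun j => rate n (φ j)) atTop →
      0 < liminf (fun j => errorProb vz W (μ (φ j)) (d (φ j))) atTop) := by
  have hbound {x : EReal} (hx : (capacity va vz W : EReal) < x) : ∃ r < x, ∃ η > 0,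
      ∀ᶠ m in atTop, r < rate n m → η ≤ errorProb vz W (μ m) (d m) := by
    obtain ⟨r, hcr, hrx⟩ := EReal.lt_iff_exists_real_btwn.1 hx
    obtain ⟨η, hη, hev⟩ := exists_pos_eventually_le_errorProb hk hvz hW (EReal.coe_lt_coe_iff.1 hcr)
    refine ⟨r, hrx, η, hη, ?_⟩
    filter_upwards [hev, eventually_ge_atTop k] with m hm hkm hr
    exact hm (n m) (hn m hkm) (EReal.coe_lt_coe_iff.1 hr) (μ m) (hμ m hkm) (hpower m hkm) _ (hd m)
  have hle : ∀ᶠ m in atTop, errorProb vz W (μ m) (d m) ≤ 1 :=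
    (eventually_ge_atTop k).mono fun m hkm => errorProb_le_one hkm W _ _
  refine ⟨fun hlt => ?_, fun φ hφ hlt => ?_⟩
  · obtain ⟨r, hr, η, hη, hev⟩ := hbound hlt
    refine hη.trans_le (le_limsup_of_frequently_le ?_ (isBoundedUnder_of_eventually_le hle))
    exact ((frequently_lt_of_lt_limsup (by isBoundedDefault) hr).and_eventually hev).mono
      fun m hm => hm.2 hm.1
  · obtain ⟨r, hr, η, hη, hev⟩ := hbound hlt
    refine hη.trans_le (le_liminf_of_le (isBoundedUnder_of_eventually_le
      (hφ.tendsto_atTop.eventually hle)).isCoboundedUnder_ge ?_)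
    filter_upwards [eventually_lt_of_lt_liminf hr (by isBoundedDefault),
      hφ.tendsto_atTop.eventually hev] with j hrate hη
    exact hη hrate

theorem theorem2 {k l : ℕ} (hk : 0 < k) (va vz : ℝ≥0) (hva : 0 < va) (hvz : 0 < vz)
    (W : Matrix (Fin k) (Fin l) ℝ) (hW : ∀ i, ∃ j, W i j ≠ 0)
    (n : ℕ → ℕ) (hn : ∀ m, k ≤ m → 0 < n m) :
    -- Gaussian measurement matrices
    (∀ d : ∀ m, Matrix (Fin (n m)) (Fin m) ℝ → Matrix (Fin (n m)) (Fin l) ℝ → Set (Fin m),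
      (∀ m, Measurable (Function.uncurry (d m))) →
        ((SupportRecovery.capacity va vz W : EReal) < limsup (SupportRecovery.rate n) atTop →
          0 < limsup (fun m => SupportRecovery.errorProbGaussian va vz W (d m)) atTop) ∧
        (∀ φ : ℕ → ℕ, StrictMono φ →
          (SupportRecovery.capacity va vz W : EReal) <
            liminf (fun j => SupportRecovery.rate n (φ j)) atTop →
          0 < liminf (fun j => SupportRecovery.errorProbGaussian va vz W (d (φ j))) atTop)) ∧
    -- arbitrary fixed measurement matrices of average power at most `va`
    (∀ (A : ∀ m, Matrix (Fin (n m)) (Fin m) ℝ)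
      (d : ∀ m, Matrix (Fin (n m)) (Fin l) ℝ → Set (Fin m)),
      (∀ m, k ≤ m → SupportRecovery.avgPower (A m) ≤ (va : ℝ)) →
      (∀ m, Measurable (d m)) →
      Tendsto (fun m => SupportRecovery.errorProbFixed vz W (A m) (d m)) atTop (𝓝 0) →
      limsup (SupportRecovery.rate n) atTop ≤ (SupportRecovery.capacity va vz W : EReal)) := by
  refine ⟨fun d hd => ?_, fun A d hA hd hlim => ?_⟩
  · simpa only [SupportRecovery.errorProb_gaussianMatrix] using
      theorem2_general hk va vz hvz W hW n hn (fun m => SupportRecovery.gaussianMatrix (n m) m va)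
        (fun _ _ => SupportRecovery.integrable_avgPower_gaussianMatrix)
        (fun _ _ => SupportRecovery.integral_avgPower_gaussianMatrix_le) d hd
  · by_contra! hlt
    have hpos := (theorem2_general hk va vz hvz W hW n hn (fun m => Measure.dirac (A m))
      (fun m _ => SupportRecovery.integrable_avgPower_dirac (A m))
      (fun m hkm => (SupportRecovery.integral_avgPower_dirac (A m)).trans_le (hA m hkm))
      (fun m _ => d m) fun m => (hd m).comp measurable_snd).1 hlt
    simp only [SupportRecovery.errorProb_dirac _ _ (hd _), hlim.limsup_eq, lt_irrefl] at hpos
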